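/- **Setting.** Let $(K,v)$ be a henselian valued field, i.e. $v$ has, up to equivalence, a unique extension to an algebraic closure $\overline K$. Let $\Lambda$ be a divisible (torsion-free) ordered abelian group containing the value group $v(K^*)$, hence its divisible hull; $v$ also denotes the extension $\overline K\to\Lambda\cup\{\infty\}$. Let $\mu\colon K[x]\to\Lambda\cup\{\infty\}$ be any valuation extending $v$; its support need not be zero. (The nodes of the tree $\mathcal T_{\mathrm{sme}}$ of the small-extensions closure are such valuations, for a particular ordered real vector space $\Lambda$.) For $F\in K[x]$ monic irreducible with root $\theta\in\overline K$, put $v_F(f)=v(f(\theta))$ for $f\in K[x]$; by henselianity this does not depend on $\theta$. Let $\mathcal G_\mu=\bigoplus_{\alpha}\{g:\mu(g)\ge\alpha\}/\{g:\mu(g)>\alpha\}$ be the graded algebra of $\mu$, and $\operatorname{in}_\mu\colon K[x]\to\mathcal G_\mu$ the initial term map: $\operatorname{in}_\mu g=0$ if $\mu(g)=\infty$, and otherwise $\operatorname{in}_\mu g$ is the class of $g$ in degree $\mu(g)$. Write $g\sim_\mu h$ if $\operatorname{in}_\mu g=\operatorname{in}_\mu h$, and $h\mid_\mu g$ if $\operatorname{in}_\mu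 h\mid\operatorname{in}_\mu g$ in $\mathcal G_\mu$. A key polynomial for $\mu$ is a monic $\phi\in K[x]$ such that $(\operatorname{in}_\mu\phi)\,\mathcal G_\mu$ is a nonzero prime ideal and $\phi\nmid_\mu f$ for all nonzero $f\in K[x]$ with $\deg f<\deg\phi$. For a key polynomial $\phi$ and $f=\sum_{s\ge0}a_s\phi^s$ with $\deg a_s<\deg\phi$, the Newton polygon $N_{\mu,\phi}(f)$ is the lower boundary of the convex hull in $\mathbb Q\times\Lambda$ of the points $(s,\mu(a_s))$ with $\mu(a_s)<\infty$. It is one-sided of slope $\sigma\in\Lambda$ if it is a single segment of slope $\sigma$ from a point of abscissa $0$ to a point of positive integer abscissa. **Theorem.** Let $F\in K[x]$ be monic irreducible and let $\phi$ be a key polynomial for $\mu$. Then $$\phi\mid_\mu F\iff \mu(\phi)<v_F(\phi).$$ Moreover, if this condition holds, then: 1. either $F=\phi$, or $v_F(\phi)<\infty$ and the Newton polygon $N_{\mu,\phi}(F)$ is one-sided of slope $-v_F(\phi)$; 2. $\deg\phi$ divides $\deg F$, and $F\sim_\mu\phi^{\ell}$ with $\ell=\deg F/\deg\phi$. -/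

import Mathlib

open Polynomial DirectSum

noncomputable section

namespace ValTree

universe u w

variable {K : Type u} [Field K]
variable {Λ : Type w} [AddCommGroup Λ] [LinearOrder Λ] [IsOrderedAddMonoid Λ]

/-- A valued field `(K, v)` is henselian if `v` has, up to equivalence, a unique extension to an
algebraic closure of `K`. Equivalence classes of valuations are identified with valuation rings:
there is exactly one valuation ring of the algebraic closure lying over the valuation ring
`{a | 0 ≤ v a}` of `v`. -/
def IsHenselian (v : AddValuation K (WithTop Λ)) : Prop :=
  ∃! O : ValuationSubring (AlgebraicClosure K),
    ∀ a : K, algebraMap K (AlgebraicClosure K) a ∈ O ↔ 0 ≤ v a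

/-- `μ` is a node of the valuative tree `𝒯(Λ)` of `v`: a valuation on `K[x]` with values in
`Λ ∪ {∞}` whose restriction to `K` is `v`. -/
def IsNode (v : AddValuation K (WithTop Λ)) (μ : AddValuation K[X] (WithTop Λ)) : Prop :=
  ∀ a : K, μ (C a) = v a

/-- The valuation `f ↦ w (f(θ))` on `K[x]`, for a valuation `w` of the algebraic closure and a
point `θ` of it. If `(K, v)` is henselian, `w` extends `v` and `θ` is a root of `F ∈ Irr(K)`,
this is `v_F`. -/
def evalValuation (w : AddValuation (AlgebraicClosure K) (WithTop Λ)) (θ : AlgebraicClosure K) :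
    AddValuation K[X] (WithTop Λ) :=
  w.comap (aeval (R := K) θ).toRingHom

section Graded

variable (μ : AddValuation K[X] (WithTop Λ))

/-- `𝒫_α = {g | μ(g) ≥ α}`. -/
def geSubgroup (α : Λ) : AddSubgroup K[X] where
  carrier := {g | (α : WithTop Λ) ≤ μ g}
  zero_mem' := by simp
  add_mem' := fun {a b} ha hb => μ.map_le_add ha hb
  neg_mem' := fun {a} ha => by simpa using ha

/-- `𝒫_α⁺ = {g | μ(g) > α}`. -/
def gtSubgroup (α : Λ) : AddSubgroup K[X] where
  carrier := {g | (α : WithTop Λ) < μ g}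
  zero_mem' := by simp
  add_mem' := fun {a b} ha hb => μ.map_lt_add ha hb
  neg_mem' := fun {a} ha => by simpa using ha

theorem mem_geSubgroup {α : Λ} {g : K[X]} : g ∈ geSubgroup μ α ↔ (α : WithTop Λ) ≤ μ g := Iff.rfl

theorem mem_gtSubgroup {α : Λ} {g : K[X]} : g ∈ gtSubgroup μ α ↔ (α : WithTop Λ) < μ g := Iff.rfl

/-- The homogeneous component `𝒫_α / 𝒫_α⁺` of degree `α`. It is zero unless `α` is the `μ`-value
of some polynomial. -/
abbrev Piece (α : Λ) : Type u :=
  geSubgroup μ α ⧸ (gtSubgroup μ α).addSubgroupOf (geSubgroup μ α)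

/-- The class of `g ∈ 𝒫_α` in `𝒫_α / 𝒫_α⁺`. -/
def Piece.mk (α : Λ) (g : K[X]) (hg : (α : WithTop Λ) ≤ μ g) : Piece μ α :=
  QuotientAddGroup.mk (⟨g, hg⟩ : geSubgroup μ α)

theorem Piece.mk_eq_iff {α : Λ} {g h : K[X]} (hg : (α : WithTop Λ) ≤ μ g)
    (hh : (α : WithTop Λ) ≤ μ h) :
    Piece.mk μ α g hg = Piece.mk μ α h hh ↔ (α : WithTop Λ) < μ (h - g) := by
  unfold Piece.mk
  rw [QuotientAddGroup.eq, AddSubgroup.mem_addSubgroupOf, mem_gtSubgroup]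
  simp [sub_eq_neg_add]

theorem Piece.exists_mk {α : Λ} (a : Piece μ α) : ∃ g hg, a = Piece.mk μ α g hg := by
  induction a using QuotientAddGroup.induction_on with
  | H z => exact ⟨z.1, z.2, rfl⟩

theorem le_map_mul {α β : Λ} {g h : K[X]} (hg : (α : WithTop Λ) ≤ μ g)
    (hh : (β : WithTop Λ) ≤ μ h) : ((α + β : Λ) : WithTop Λ) ≤ μ (g * h) := by
  rw [μ.map_mul, WithTop.coe_add]
  exact add_le_add hg hh

theorem lt_map_mul {α β : Λ} {g h : K[X]} (hg : (α : WithTop Λ) < μ g)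
    (hh : (β : WithTop Λ) ≤ μ h) : ((α + β : Λ) : WithTop Λ) < μ (g * h) := by
  rw [μ.map_mul, WithTop.coe_add]
  exact WithTop.add_lt_add_of_lt_of_le (WithTop.coe_ne_top) hg hh

/-- Multiplication `𝒫_α/𝒫_α⁺ × 𝒫_β/𝒫_β⁺ → 𝒫_{α+β}/𝒫_{α+β}⁺` induced by that of `K[x]`. -/
def Piece.mul {α β : Λ} (a : Piece μ α) (b : Piece μ β) : Piece μ (α + β) :=
  Quotient.liftOn₂' a b (fun g h => Piece.mk μ (α + β) (g.1 * h.1) (le_map_mul μ g.2 h.2)) (by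
    rintro ⟨g, hg⟩ ⟨h, hh⟩ ⟨g', hg'⟩ ⟨h', hh'⟩ h1 h2
    rw [QuotientAddGroup.leftRel_apply, AddSubgroup.mem_addSubgroupOf, mem_gtSubgroup] at h1 h2
    rw [Piece.mk_eq_iff]
    have e : g' * h' - g * h = (-g + g') * h' + (-h + h') * g := by ring
    simp only [e]
    refine μ.map_lt_add (lt_map_mul μ h1 hh') ?_
    rw [add_comm α β]
    exact lt_map_mul μ h2 hg)

theorem Piece.mk_add_mk {α : Λ} {g h : K[X]} (hg : (α : WithTop Λ) ≤ μ g)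
    (hh : (α : WithTop Λ) ≤ μ h) :
    Piece.mk μ α g hg + Piece.mk μ α h hh = Piece.mk μ α (g + h) (μ.map_le_add hg hh) := rfl

theorem Piece.zero_eq_mk (α : Λ) : (0 : Piece μ α) = Piece.mk μ α 0 (by simp) := rfl

theorem Piece.sigma_mk_eq {α β : Λ} (e : α = β) {g h : K[X]} (f : g = h)
    (hg : (α : WithTop Λ) ≤ μ g) (hh : (β : WithTop Λ) ≤ μ h) :
    (GradedMonoid.mk α (Piece.mk μ α g hg) : GradedMonoid (Piece μ)) =
      GradedMonoid.mk β (Piece.mk μ β h hh) := by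
  subst e f; rfl

theorem zero_le_map_one : ((0 : Λ) : WithTop Λ) ≤ μ 1 := by simp

instance gMul : GradedMonoid.GMul (Piece μ) where
  mul := Piece.mul μ

theorem Piece.mk_mul_mk {α β : Λ} {g h : K[X]} (hg : (α : WithTop Λ) ≤ μ g)
    (hh : (β : WithTop Λ) ≤ μ h) :
    GradedMonoid.GMul.mul (Piece.mk μ α g hg) (Piece.mk μ β h hh) =
      Piece.mk μ (α + β) (g * h) (le_map_mul μ hg hh) := rfl

instance gOne : GradedMonoid.GOne (Piece μ) where
  one := Piece.mk μ 0 1 (zero_le_map_one μ)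

instance gCommRing : DirectSum.GCommRing (Piece μ) where
  toGMul := gMul μ
  toGOne := gOne μ
  mul_zero := by
    intro α β a
    obtain ⟨g, hg, rfl⟩ := Piece.exists_mk μ a
    rw [Piece.zero_eq_mk, Piece.zero_eq_mk, Piece.mk_mul_mk]
    simp
  zero_mul := by
    intro α β a
    obtain ⟨g, hg, rfl⟩ := Piece.exists_mk μ a
    rw [Piece.zero_eq_mk, Piece.zero_eq_mk, Piece.mk_mul_mk]
    simp
  mul_add := by
    intro α β a b c
    obtain ⟨g, hg, rfl⟩ := Piece.exists_mk μ a
    obtain ⟨h, hh, rfl⟩ := Piece.exists_mk μ b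
    obtain ⟨k, hk, rfl⟩ := Piece.exists_mk μ c
    simp only [Piece.mk_add_mk, Piece.mk_mul_mk, mul_add]
  add_mul := by
    intro α β a b c
    obtain ⟨g, hg, rfl⟩ := Piece.exists_mk μ a
    obtain ⟨h, hh, rfl⟩ := Piece.exists_mk μ b
    obtain ⟨k, hk, rfl⟩ := Piece.exists_mk μ c
    simp only [Piece.mk_add_mk, Piece.mk_mul_mk, add_mul]
  one_mul := by
    rintro ⟨α, a⟩
    obtain ⟨g, hg, rfl⟩ := Piece.exists_mk μ a
    exact Piece.sigma_mk_eq μ (zero_add α) (one_mul g) _ _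
  mul_one := by
    rintro ⟨α, a⟩
    obtain ⟨g, hg, rfl⟩ := Piece.exists_mk μ a
    exact Piece.sigma_mk_eq μ (add_zero α) (mul_one g) _ _
  mul_assoc := by
    rintro ⟨α, a⟩ ⟨β, b⟩ ⟨γ, c⟩
    obtain ⟨g, hg, rfl⟩ := Piece.exists_mk μ a
    obtain ⟨h, hh, rfl⟩ := Piece.exists_mk μ b
    obtain ⟨k, hk, rfl⟩ := Piece.exists_mk μ c
    exact Piece.sigma_mk_eq μ (add_assoc α β γ) (mul_assoc g h k) _ _
  mul_comm := by
    rintro ⟨α, a⟩ ⟨β, b⟩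
    obtain ⟨g, hg, rfl⟩ := Piece.exists_mk μ a
    obtain ⟨h, hh, rfl⟩ := Piece.exists_mk μ b
    exact Piece.sigma_mk_eq μ (add_comm α β) (mul_comm g h) _ _
  natCast := fun n => n • Piece.mk μ 0 1 (zero_le_map_one μ)
  natCast_zero := zero_nsmul _
  natCast_succ := fun n => succ_nsmul _ n
  intCast := fun n => n • Piece.mk μ 0 1 (zero_le_map_one μ)
  intCast_ofNat := fun n => natCast_zsmul _ n
  intCast_negSucc_ofNat := fun n => negSucc_zsmul _ n

/-- The graded algebra `𝒢_μ = ⨁_α 𝒫_α / 𝒫_α⁺`. Letting `α` run over `Λ` instead of the value group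
of `μ` only adds zero components. -/
abbrev GradedAlg : Type (max u w) := ⨁ α : Λ, Piece μ α

open Classical in
/-- The initial term map `in_μ : K[x] → 𝒢_μ`. It sends the support of `μ` to `0`, and any other `g`
to its class in the component of degree `μ(g)`. -/
def initialTerm (g : K[X]) : GradedAlg μ :=
  if hg : μ g = ⊤ then 0
  else DirectSum.of (Piece μ) ((μ g).untop hg)
    (Piece.mk μ ((μ g).untop hg) g (by rw [WithTop.coe_untop]))

/-- `g ∼_μ h`. -/
def MuEquiv (g h : K[X]) : Prop := initialTerm μ g = initialTerm μ h

/-- `h ∣_μ g`. -/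
def MuDvd (h g : K[X]) : Prop := initialTerm μ h ∣ initialTerm μ g

/-- `g` is `μ`-irreducible: `in_μ g` generates a nonzero prime ideal of `𝒢_μ`. -/
def MuIrreducible (g : K[X]) : Prop :=
  Ideal.span {initialTerm μ g} ≠ ⊥ ∧ (Ideal.span {initialTerm μ g}).IsPrime

/-- `g` is `μ`-minimal. -/
def MuMinimal (g : K[X]) : Prop := ∀ f : K[X], f ≠ 0 → f.degree < g.degree → ¬ MuDvd μ g f

/-- MacLane–Vaquié key polynomials for `μ`. -/
structure IsKeyPolynomial (φ : K[X]) : Prop where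
  monic : φ.Monic
  minimal : MuMinimal μ φ
  irreducible : MuIrreducible μ φ

end Graded

/-- The `s`-th coefficient `a_s` of the `φ`-expansion `f = ∑ a_s φ^s`, `deg a_s < deg φ`, of `f` with
respect to a monic polynomial `φ` of positive degree: the remainder modulo `φ` of the quotient of
`f` by `φ^s`. -/
def expansionCoeff (φ f : K[X]) (s : ℕ) : K[X] := (f /ₘ φ ^ s) %ₘ φ

section Newton

variable [Module ℚ Λ]

/-- The cloud of points `(s, μ(a_s))`, `a_s ≠ 0`, where `f = ∑ a_s φ^s` is the `φ`-expansion. -/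
def newtonCloud (μ : AddValuation K[X] (WithTop Λ)) (φ f : K[X]) : Set (ℚ × Λ) :=
  {p | ∃ s : ℕ, p.1 = s ∧ (p.2 : WithTop Λ) = μ (expansionCoeff φ f s)}

/-- The Newton polygon `N_{μ,φ}(f)`: the lower boundary of the convex hull of the cloud of points
`(s, μ(a_s))` in `ℚ × Λ`. -/
def newtonPolygon (μ : AddValuation K[X] (WithTop Λ)) (φ f : K[X]) : Set (ℚ × Λ) :=
  {p | p ∈ convexHull ℚ (newtonCloud μ φ f) ∧
    ∀ y : Λ, (p.1, y) ∈ convexHull ℚ (newtonCloud μ φ f) → p.2 ≤ y}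

/-- `N` is one-sided of slope `σ`: it is a single segment of slope `σ` and positive length,
starting on the vertical axis. -/
def IsOneSided (N : Set (ℚ × Λ)) (σ : Λ) : Prop :=
  ∃ (y : Λ) (l : ℕ), 0 < l ∧ N = segment ℚ (0, y) ((l : ℚ), y + l • σ)

end Newton

end ValTree

end

/-!
Let `θ` be a root of `F`, put `β = φ(θ)` and `δ = v(β)`, and let `g` be the minimal polynomial of
`β` over `K`. By henselianity all conjugates of `β` have value `δ`, so the Newton polygon of `g` is
one-sided of slope `-δ`. Hence so is the one of the multiple `G = g(φ)` of `F`, whose coefficients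
in the `φ`-expansion are those of `g`: every valuation `ω` on `K[x]` that extends `v` and satisfies
`δ ≤ ω(φ)` takes on `G` at least the value `μ(G mod φ) = deg(g) δ`. If moreover
`ω(f) ≤ μ(f mod φ)` for all `f`, then `ω(G) = μ(G mod φ)`. Since `f ↦ μ(f mod φ)` is itself a
valuation, two valuations one of which dominates the other agree on `G`, and thus on its divisor
`F`.

If `δ ≤ μ(φ)`, then `ω = μ` is such a valuation, and `μ(F) = μ(F mod φ)` says that `φ` does not
divide `F` in the graded algebra. If `μ(φ) < δ < ∞`, then `ω` can be taken to be Mac Lane's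
augmentation `[μ; φ, δ]`, which maps `∑ a_s φ ^ s` to `min_s (μ(a_s) + s δ)`. In this case the bound
`deg(φ) ω(f) ≤ deg(f) δ`, valid for monic `f`, is attained at `G` as well, hence at `F`. This pins
down both ends of the Newton polygon of `F`, and `F - φ ^ ℓ` has larger `μ`-value than `φ ^ ℓ`
because its `φ`-expansion has degree less than `ℓ` and `μ(φ) < δ`.
-/

noncomputable section

namespace ValTree

universe u w

section InitialTerm

variable {K : Type u} [Field K]
variable {Λ : Type w} [AddCommGroup Λ] [LinearOrder Λ] [IsOrderedAddMonoid Λ]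
variable {μ : AddValuation K[X] (WithTop Λ)}

theorem initialTerm_eq_of {g : K[X]} {α : Λ} (h : μ g = α) :
    initialTerm μ g = DirectSum.of (Piece μ) α (Piece.mk μ α g h.ge) := by
  have hg : μ g ≠ ⊤ := by simp [h]
  have hα : (μ g).untop hg = α := by simp [h]
  rw [initialTerm, dif_neg hg]
  subst hα
  rfl

theorem initialTerm_eq_zero_iff {g : K[X]} : initialTerm μ g = 0 ↔ μ g = ⊤ := by
  refine ⟨fun h => ?_, fun h => by rw [initialTerm, dif_pos h]⟩
  by_contra hg
  obtain ⟨α, hα⟩ := WithTop.ne_top_iff_exists.1 hg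
  have hpiece : Piece.mk μ α g hα.le = 0 := by
    simpa only [initialTerm_eq_of hα.symm, DirectSum.of_eq_same, DirectSum.zero_apply] using
      congrArg (fun G : GradedAlg μ => G α) h
  rw [Piece.zero_eq_mk, Piece.mk_eq_iff, zero_sub, μ.map_neg, hα] at hpiece
  exact lt_irrefl _ hpiece

theorem initialTerm_mul (f g : K[X]) :
    initialTerm μ (f * g) = initialTerm μ f * initialTerm μ g := by
  by_cases hf : μ f = ⊤
  · rw [initialTerm_eq_zero_iff.2 hf, zero_mul, initialTerm_eq_zero_iff, μ.map_mul, hf, top_add]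
  by_cases hg : μ g = ⊤
  · rw [initialTerm_eq_zero_iff.2 hg, mul_zero, initialTerm_eq_zero_iff, μ.map_mul, hg, add_top]
  obtain ⟨α, hα⟩ := WithTop.ne_top_iff_exists.1 hf
  obtain ⟨β, hβ⟩ := WithTop.ne_top_iff_exists.1 hg
  rw [initialTerm_eq_of hα.symm, initialTerm_eq_of hβ.symm, DirectSum.of_mul_of,
    Piece.mk_mul_mk]
  exact initialTerm_eq_of (by rw [μ.map_mul, ← hα, ← hβ, WithTop.coe_add])

theorem initialTerm_one : initialTerm μ 1 = 1 :=
  initialTerm_eq_of (α := 0) (by simp)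

theorem muEquiv_of_lt {f g : K[X]} (h : μ f < μ (g - f)) : MuEquiv μ f g := by
  have hg : μ g = μ f := μ.map_eq_of_lt_sub h
  obtain ⟨α, hα⟩ := WithTop.ne_top_iff_exists.1 h.ne_top
  rw [MuEquiv, initialTerm_eq_of hα.symm, initialTerm_eq_of (hg.trans hα.symm)]
  congr 1
  rwa [Piece.mk_eq_iff, hα]

theorem MuEquiv.muDvd_of_dvd {f g h : K[X]} (hfg : MuEquiv μ f g) (hhg : h ∣ g) :
    MuDvd μ h f := by
  obtain ⟨q, rfl⟩ := hhg
  exact ⟨initialTerm μ q, by rw [← initialTerm_mul]; exact hfg⟩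

theorem muDvd_of_lt {φ f q : K[X]} (h : μ f < μ (f - φ * q)) : MuDvd μ φ f :=
  (muEquiv_of_lt (by rwa [μ.map_sub_swap])).muDvd_of_dvd (dvd_mul_right φ q)

theorem exists_initialTerm_mul_apply_eq {φ : K[X]} (hφ : μ φ ≠ ⊤) (G : GradedAlg μ) (β : Λ) :
    ∃ (q : K[X]) (hq : (β : WithTop Λ) ≤ μ (φ * q)),
      (initialTerm μ φ * G) β = Piece.mk μ β (φ * q) hq := by
  obtain ⟨α, hα⟩ := WithTop.ne_top_iff_exists.1 hφ
  induction G using DirectSum.induction_on with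
  | zero => exact ⟨0, by simp, by simp [Piece.zero_eq_mk]⟩
  | of i x =>
    obtain ⟨g, hg, rfl⟩ := Piece.exists_mk μ x
    rw [initialTerm_eq_of hα.symm, DirectSum.of_mul_of, Piece.mk_mul_mk]
    rcases eq_or_ne β (α + i) with rfl | hne
    · exact ⟨g, le_map_mul μ hα.le hg, by rw [DirectSum.of_eq_same]⟩
    · exact ⟨0, by simp, by rw [DirectSum.of_eq_of_ne _ _ _ hne]; simp [Piece.zero_eq_mk]⟩
  | add x y hx hy =>
    obtain ⟨q, hq, hxq⟩ := hx
    obtain ⟨r, hr, hyr⟩ := hy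
    refine ⟨q + r, by rw [mul_add]; exact μ.map_le_add hq hr, ?_⟩
    rw [mul_add, DirectSum.add_apply, hxq, hyr, Piece.mk_add_mk]
    simp only [mul_add]

theorem MuDvd.exists_lt {φ f : K[X]} (h : MuDvd μ φ f) (hφ : μ φ ≠ ⊤) (hf : μ f ≠ ⊤) :
    ∃ q, μ f < μ (f - φ * q) := by
  obtain ⟨G, hG⟩ := h
  obtain ⟨β, hβ⟩ := WithTop.ne_top_iff_exists.1 hf
  obtain ⟨q, hq, hqG⟩ := exists_initialTerm_mul_apply_eq hφ G β
  rw [← hG, initialTerm_eq_of hβ.symm, DirectSum.of_eq_same, Piece.mk_eq_iff,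
    μ.map_sub_swap] at hqG
  exact ⟨q, by rwa [← hβ]⟩

end InitialTerm

section Division

variable {R : Type*} [Ring R] {φ : R[X]}

theorem add_mul_modByMonic (hφ : φ.Monic) {a f : R[X]} (ha : a.degree < φ.degree) :
    (a + φ * f) %ₘ φ = a :=
  (div_modByMonic_unique f a hφ ⟨rfl, ha⟩).2

theorem add_mul_divByMonic (hφ : φ.Monic) {a f : R[X]} (ha : a.degree < φ.degree) :
    (a + φ * f) /ₘ φ = f :=
  (div_modByMonic_unique f a hφ ⟨rfl, ha⟩).1

theorem add_divByMonic (hφ : φ.Monic) (f g : R[X]) : (f + g) /ₘ φ = f /ₘ φ + g /ₘ φ := by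
  nontriviality R
  refine (div_modByMonic_unique _ (f %ₘ φ + g %ₘ φ) hφ ⟨?_, ?_⟩).1
  · rw [mul_add, add_add_add_comm, modByMonic_add_div, modByMonic_add_div]
  · exact (degree_add_le _ _).trans_lt
      (max_lt (degree_modByMonic_lt f hφ) (degree_modByMonic_lt g hφ))

theorem divByMonic_mul (hφ : φ.Monic) {ψ : R[X]} (hψ : ψ.Monic) (f : R[X]) :
    f /ₘ (φ * ψ) = f /ₘ φ /ₘ ψ := by
  nontriviality R
  refine (div_modByMonic_unique _ (f %ₘ φ + φ * (f /ₘ φ %ₘ ψ)) (hφ.mul hψ) ⟨?_, ?_⟩).1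
  · rw [mul_assoc, add_assoc, ← mul_add, modByMonic_add_div, modByMonic_add_div]
  · rw [hψ.degree_mul]
    refine (degree_add_le _ _).trans_lt (max_lt ?_ ?_)
    · exact (degree_modByMonic_lt f hφ).trans_le
        (le_add_of_nonneg_right (zero_le_degree_iff.2 hψ.ne_zero))
    · rw [hφ.degree_mul_comm, hφ.degree_mul, add_comm]
      exact WithBot.add_lt_add_left (degree_ne_bot.2 hφ.ne_zero) (degree_modByMonic_lt _ hψ)

theorem degree_sub_lt_of_monic [Nontrivial R] {f : R[X]} (hf : f.Monic) (hφ : φ.Monic)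
    (hdeg : f.natDegree = φ.natDegree) : (f - φ).degree < φ.degree :=
  degree_sub_lt_right
    (by rw [degree_eq_natDegree hf.ne_zero, degree_eq_natDegree hφ.ne_zero, hdeg]) hφ.ne_zero
    (hf.leadingCoeff.trans hφ.leadingCoeff.symm)

theorem divByMonic_eq_one_of_monic {f : R[X]} (hf : f.Monic) (hφ : φ.Monic)
    (hdeg : f.natDegree = φ.natDegree) : f /ₘ φ = 1 := by
  nontriviality R
  exact (div_modByMonic_unique 1 (f - φ) hφ ⟨by simp, degree_sub_lt_of_monic hf hφ hdeg⟩).1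

theorem expansion_induction {motive : R[X] → Prop} (hφ : φ.Monic) (hdeg : 0 < φ.natDegree)
    (zero : motive 0)
    (add_mul : ∀ a f, a.degree < φ.degree → motive f → motive (a + φ * f)) (f : R[X]) :
    motive f := by
  rcases subsingleton_or_nontrivial R with _ | _
  · rwa [Subsingleton.elim f 0]
  induction hn : f.natDegree using Nat.strong_induction_on generalizing f with
  | _ n ih =>
    rw [← modByMonic_add_div f φ]
    refine add_mul _ _ (degree_modByMonic_lt f hφ) ?_
    by_cases hlt : f.natDegree < φ.natDegree
    · rwa [(divByMonic_eq_zero_iff hφ).2 (degree_lt_degree hlt)]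
    · exact ih _ (by rw [natDegree_divByMonic f hφ]; omega) _ rfl

end Division

section Expansion

variable {K : Type u} [Field K] {φ : K[X]}

theorem expansionCoeff_zero (φ f : K[X]) : expansionCoeff φ f 0 = f %ₘ φ := by
  rw [expansionCoeff, pow_zero, divByMonic_one]

theorem expansionCoeff_succ (hφ : φ.Monic) (f : K[X]) (s : ℕ) :
    expansionCoeff φ f (s + 1) = expansionCoeff φ (f /ₘ φ) s := by
  rw [expansionCoeff, pow_succ', divByMonic_mul hφ (hφ.pow s), expansionCoeff]

theorem expansionCoeff_add (hφ : φ.Monic) (f g : K[X]) (s : ℕ) :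
    expansionCoeff φ (f + g) s = expansionCoeff φ f s + expansionCoeff φ g s := by
  rw [expansionCoeff, add_divByMonic (hφ.pow s), add_modByMonic, expansionCoeff, expansionCoeff]

theorem expansionCoeff_eq_zero (hφ : φ.Monic) {f : K[X]} {s : ℕ}
    (h : f.natDegree < s * φ.natDegree) : expansionCoeff φ f s = 0 := by
  rw [expansionCoeff, (divByMonic_eq_zero_iff (hφ.pow s)).2 (degree_lt_degree ?_), zero_modByMonic]
  rwa [natDegree_pow]

theorem expansionCoeff_eq_one (hφ : φ.Monic) (hdeg : 0 < φ.natDegree) {f : K[X]} (hf : f.Monic)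
    {s : ℕ} (hs : f.natDegree = s * φ.natDegree) : expansionCoeff φ f s = 1 := by
  rw [expansionCoeff, divByMonic_eq_one_of_monic hf (hφ.pow s) (by rw [hs, natDegree_pow]),
    modByMonic_eq_self_iff hφ]
  exact degree_lt_degree (by simpa using hdeg)

end Expansion

section KeyPolynomial

variable {K : Type u} [Field K]
variable {Λ : Type w} [AddCommGroup Λ] [LinearOrder Λ] [IsOrderedAddMonoid Λ]
variable {μ : AddValuation K[X] (WithTop Λ)} {φ : K[X]}

namespace IsKeyPolynomial

theorem map_ne_top (hφ : IsKeyPolynomial μ φ) : μ φ ≠ ⊤ := by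
  intro h
  apply hφ.irreducible.1
  rw [initialTerm_eq_zero_iff.2 h, Ideal.span_singleton_eq_bot]

theorem ne_one (hφ : IsKeyPolynomial μ φ) : φ ≠ 1 := by
  rintro rfl
  apply hφ.irreducible.2.ne_top
  rw [initialTerm_one, Ideal.span_singleton_one]

theorem natDegree_pos (hφ : IsKeyPolynomial μ φ) : 0 < φ.natDegree :=
  Nat.pos_of_ne_zero fun h => hφ.ne_one (hφ.monic.natDegree_eq_zero.1 h)

theorem muDvd_or_muDvd (hφ : IsKeyPolynomial μ φ) {f g : K[X]} (h : MuDvd μ φ (f * g)) :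
    MuDvd μ φ f ∨ MuDvd μ φ g := by
  have hprime := hφ.irreducible.2.mem_or_mem (x := initialTerm μ f) (y := initialTerm μ g)
    (by rw [← initialTerm_mul]; exact Ideal.mem_span_singleton.2 h)
  rwa [Ideal.mem_span_singleton, Ideal.mem_span_singleton] at hprime

theorem natDegree_le_of_muDvd (hφ : IsKeyPolynomial μ φ) {f : K[X]} (hf : f ≠ 0)
    (h : MuDvd μ φ f) : φ.natDegree ≤ f.natDegree :=
  not_lt.1 fun hlt => hφ.minimal f hf (degree_lt_degree hlt) h

theorem irreducible_polynomial (hφ : IsKeyPolynomial μ φ) : Irreducible φ := by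
  rw [hφ.monic.irreducible_iff_natDegree]
  refine ⟨hφ.ne_one, fun f g hf hg hfg => ?_⟩
  have hdeg : f.natDegree + g.natDegree = φ.natDegree := by rw [← hfg, hf.natDegree_mul hg]
  rcases hφ.muDvd_or_muDvd (f := f) (g := g) (by rw [hfg]; exact dvd_rfl) with h | h
  · have := hφ.natDegree_le_of_muDvd hf.ne_zero h
    omega
  · have := hφ.natDegree_le_of_muDvd hg.ne_zero h
    omega

theorem map_le_map_modByMonic (hφ : IsKeyPolynomial μ φ) (f : K[X]) : μ f ≤ μ (f %ₘ φ) := by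
  by_contra! hlt
  have hr : f %ₘ φ ≠ 0 := fun h => by simp [h] at hlt
  refine hφ.minimal _ hr (degree_modByMonic_lt f hφ.monic) (muDvd_of_lt (q := -(f /ₘ φ)) ?_)
  rwa [mul_neg, sub_neg_eq_add, modByMonic_add_div]

theorem map_mul_modByMonic_of_degree_lt (hφ : IsKeyPolynomial μ φ) {a b : K[X]}
    (ha : a.degree < φ.degree) (hb : b.degree < φ.degree) :
    μ ((a * b) %ₘ φ) = μ a + μ b := by
  rcases eq_or_ne a 0 with rfl | ha0
  · simp
  rcases eq_or_ne b 0 with rfl | hb0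
  · simp
  rw [← μ.map_mul]
  refine ((hφ.map_le_map_modByMonic _).eq_of_not_lt fun hlt => ?_).symm
  have hdvd : MuDvd μ φ (a * b) :=
    muDvd_of_lt (q := a * b /ₘ φ) (by rwa [sub_eq_of_eq_add (modByMonic_add_div _ φ).symm])
  exact (hφ.muDvd_or_muDvd hdvd).elim (hφ.minimal a ha0 ha) (hφ.minimal b hb0 hb)

theorem eq_zero_of_map_eq_top (hφ : IsKeyPolynomial μ φ) {f : K[X]} (hf : μ f = ⊤) : f = 0 := by
  induction f using expansion_induction hφ.monic hφ.natDegree_pos with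
  | zero => rfl
  | add_mul a f ha ih =>
    have hμa : μ a = ⊤ := top_unique (by
      simpa only [hf, add_mul_modByMonic hφ.monic ha] using hφ.map_le_map_modByMonic (a + φ * f))
    have ha0 : a = 0 := by
      by_contra h0
      exact hφ.minimal a h0 ha (by rw [MuDvd, initialTerm_eq_zero_iff.2 hμa]; exact dvd_zero _)
    rw [ha0, zero_add, μ.map_mul, WithTop.add_eq_top] at hf
    rw [ha0, ih (hf.resolve_left hφ.map_ne_top), mul_zero, add_zero]

theorem muDvd_iff (hφ : IsKeyPolynomial μ φ) {f : K[X]} (hf : f ≠ 0) :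
    MuDvd μ φ f ↔ μ f < μ (f %ₘ φ) := by
  constructor
  · intro h
    obtain ⟨q, hq⟩ := h.exists_lt hφ.map_ne_top (mt hφ.eq_zero_of_map_eq_top hf)
    have hrem : (f - φ * q) %ₘ φ = f %ₘ φ := by
      rw [sub_modByMonic, self_mul_modByMonic hφ.monic, sub_zero]
    exact hq.trans_le (hrem ▸ hφ.map_le_map_modByMonic _)
  · intro h
    refine muDvd_of_lt (q := f /ₘ φ) ?_
    rwa [sub_eq_of_eq_add (modByMonic_add_div f φ).symm]

end IsKeyPolynomial

section Augmentation

variable {γ : WithTop Λ}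

/-- The value `min_s (μ(a_s) + s γ)` of `f = ∑ a_s φ ^ s` under Mac Lane's augmentation
`[μ; φ, γ]`. The minimum may be taken over `s ≤ deg f` when `φ` is monic of positive degree, as
`a_s = 0` for all other `s`. -/
def augmentedValue (μ : AddValuation K[X] (WithTop Λ)) (φ : K[X]) (γ : WithTop Λ) (f : K[X]) :
    WithTop Λ :=
  (Finset.range (f.natDegree + 1)).inf fun s => μ (expansionCoeff φ f s) + s • γ

theorem exists_augmentedValue_eq (μ : AddValuation K[X] (WithTop Λ)) (φ : K[X]) (γ : WithTop Λ)
    (f : K[X]) : ∃ s : ℕ, augmentedValue μ φ γ f = μ (expansionCoeff φ f s) + s • γ := by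
  obtain ⟨s, -, hs⟩ := Finset.exists_mem_eq_inf (Finset.range (f.natDegree + 1))
    Finset.nonempty_range_add_one fun s => μ (expansionCoeff φ f s) + s • γ
  exact ⟨s, hs⟩

theorem augmentedValue_zero (μ : AddValuation K[X] (WithTop Λ)) (φ : K[X]) (γ : WithTop Λ) :
    augmentedValue μ φ γ 0 = ⊤ := by
  simp [augmentedValue, expansionCoeff]

theorem augmentedValue_le (hφ : φ.Monic) (hdeg : 0 < φ.natDegree) (f : K[X]) (s : ℕ) :
    augmentedValue μ φ γ f ≤ μ (expansionCoeff φ f s) + s • γ := by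
  by_cases hs : s ≤ f.natDegree
  · exact Finset.inf_le (Finset.mem_range_succ_iff.2 hs)
  · rw [expansionCoeff_eq_zero hφ (by nlinarith), μ.map_zero, top_add]
    exact le_top

theorem min_le_augmentedValue_add (hφ : φ.Monic) (hdeg : 0 < φ.natDegree) (f g : K[X]) :
    min (augmentedValue μ φ γ f) (augmentedValue μ φ γ g) ≤ augmentedValue μ φ γ (f + g) := by
  obtain ⟨s, hs⟩ := exists_augmentedValue_eq μ φ γ (f + g)
  rw [hs, expansionCoeff_add hφ]
  refine (min_le_min (augmentedValue_le hφ hdeg f s) (augmentedValue_le hφ hdeg g s)).trans ?_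
  rw [min_add_add_right]
  gcongr
  exact μ.map_add _ _

theorem augmentedValue_add_mul (hφ : φ.Monic) (hdeg : 0 < φ.natDegree) {a : K[X]}
    (ha : a.degree < φ.degree) (f : K[X]) :
    augmentedValue μ φ γ (a + φ * f) = min (μ a) (γ + augmentedValue μ φ γ f) := by
  have hzero : expansionCoeff φ (a + φ * f) 0 = a := by
    rw [expansionCoeff_zero, add_mul_modByMonic hφ ha]
  have hsucc (s : ℕ) : expansionCoeff φ (a + φ * f) (s + 1) = expansionCoeff φ f s := by
    rw [expansionCoeff_succ hφ, add_mul_divByMonic hφ ha]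
  refine le_antisymm (le_min ?_ ?_) ?_
  · simpa [hzero] using augmentedValue_le (μ := μ) (γ := γ) hφ hdeg (a + φ * f) 0
  · obtain ⟨s, hs⟩ := exists_augmentedValue_eq μ φ γ f
    refine (augmentedValue_le hφ hdeg (a + φ * f) (s + 1)).trans_eq ?_
    rw [hs, hsucc, succ_nsmul', add_left_comm]
  · obtain ⟨s, hs⟩ := exists_augmentedValue_eq μ φ γ (a + φ * f)
    rw [hs]
    cases s with
    | zero => simp [hzero]
    | succ s =>
      rw [hsucc, succ_nsmul', add_left_comm]
      exact min_le_of_right_le (by gcongr; exact augmentedValue_le hφ hdeg f s)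

theorem augmentedValue_of_degree_lt (hφ : φ.Monic) (hdeg : 0 < φ.natDegree) {a : K[X]}
    (ha : a.degree < φ.degree) : augmentedValue μ φ γ a = μ a := by
  simpa [augmentedValue_zero] using augmentedValue_add_mul (μ := μ) (γ := γ) hφ hdeg ha 0

theorem augmentedValue_mul (hφ : φ.Monic) (hdeg : 0 < φ.natDegree) (f : K[X]) :
    augmentedValue μ φ γ (φ * f) = γ + augmentedValue μ φ γ f := by
  simpa using augmentedValue_add_mul (μ := μ) (γ := γ) hφ hdeg (a := 0)
    (bot_lt_iff_ne_bot.2 (degree_ne_bot.2 hφ.ne_zero)) f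

namespace IsKeyPolynomial

theorem map_le_augmentedValue (hφ : IsKeyPolynomial μ φ) (hγ : μ φ ≤ γ) (f : K[X]) :
    μ f ≤ augmentedValue μ φ γ f := by
  induction f using expansion_induction hφ.monic hφ.natDegree_pos with
  | zero => rw [augmentedValue_zero]; exact le_top
  | add_mul a f ha ih =>
    have hle : μ (a + φ * f) ≤ μ a := by
      simpa only [add_mul_modByMonic hφ.monic ha] using hφ.map_le_map_modByMonic (a + φ * f)
    rw [augmentedValue_add_mul hφ.monic hφ.natDegree_pos ha]
    refine le_min hle ?_
    calc μ (a + φ * f) ≤ μ (φ * f) := by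
          simpa only [add_sub_cancel_left] using μ.map_le_sub le_rfl hle
      _ = μ φ + μ f := μ.map_mul φ f
      _ ≤ γ + augmentedValue μ φ γ f := add_le_add hγ ih

theorem map_add_augmentedValue_le (hφ : IsKeyPolynomial μ φ) (hγ : μ φ ≤ γ) (a g : K[X]) :
    μ a + augmentedValue μ φ γ g ≤ augmentedValue μ φ γ (a * g) := by
  induction g using expansion_induction hφ.monic hφ.natDegree_pos with
  | zero => rw [mul_zero, augmentedValue_zero]; exact le_top
  | add_mul b g hb ih =>
    rw [augmentedValue_add_mul hφ.monic hφ.natDegree_pos hb, ← min_add_add_left, mul_add,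
      mul_left_comm]
    refine (min_le_min ?_ ?_).trans
      (min_le_augmentedValue_add hφ.monic hφ.natDegree_pos (a * b) (φ * (a * g)))
    · rw [← μ.map_mul]
      exact hφ.map_le_augmentedValue hγ (a * b)
    · rw [augmentedValue_mul hφ.monic hφ.natDegree_pos, add_left_comm]
      gcongr

theorem augmentedValue_add_le (hφ : IsKeyPolynomial μ φ) (hγ : μ φ ≤ γ) (f g : K[X]) :
    augmentedValue μ φ γ f + augmentedValue μ φ γ g ≤ augmentedValue μ φ γ (f * g) := by
  induction f using expansion_induction hφ.monic hφ.natDegree_pos with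
  | zero => rw [zero_mul, augmentedValue_zero]; exact le_top
  | add_mul a f ha ih =>
    rw [augmentedValue_add_mul hφ.monic hφ.natDegree_pos ha, ← min_add_add_right, add_mul,
      mul_assoc]
    refine (min_le_min (hφ.map_add_augmentedValue_le hγ a g) ?_).trans
      (min_le_augmentedValue_add hφ.monic hφ.natDegree_pos (a * g) (φ * (f * g)))
    rw [augmentedValue_mul hφ.monic hφ.natDegree_pos, add_assoc]
    gcongr

theorem augmentedValue_add_mul_mul_le (hφ : IsKeyPolynomial μ φ) (hγ : μ φ ≤ γ) {a f g : K[X]}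
    (ha : a.degree < φ.degree) (hlt : augmentedValue μ φ γ (a + φ * f) < μ a)
    (hfg : augmentedValue μ φ γ (f * g) ≤ augmentedValue μ φ γ f + augmentedValue μ φ γ g) :
    augmentedValue μ φ γ ((a + φ * f) * g) ≤
      augmentedValue μ φ γ (a + φ * f) + augmentedValue μ φ γ g := by
  have hdom : augmentedValue μ φ γ (a + φ * f) = γ + augmentedValue μ φ γ f := by
    rw [augmentedValue_add_mul hφ.monic hφ.natDegree_pos ha] at hlt ⊢
    exact min_eq_right ((min_lt_iff.1 hlt).resolve_left (lt_irrefl _)).le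
  by_contra! hprod
  have hg : augmentedValue μ φ γ g ≠ ⊤ := fun h => by simp [h] at hprod
  have htail : augmentedValue μ φ γ (a + φ * f) + augmentedValue μ φ γ g <
      augmentedValue μ φ γ (-a * g) := by
    refine lt_of_lt_of_le (WithTop.add_lt_add_right hg hlt) ?_
    rw [← μ.map_neg]
    exact hφ.map_add_augmentedValue_le hγ (-a) g
  have hstrict := (lt_min hprod htail).trans_le
    (min_le_augmentedValue_add hφ.monic hφ.natDegree_pos _ _)
  rw [show (a + φ * f) * g + -a * g = φ * (f * g) by ring,
    augmentedValue_mul hφ.monic hφ.natDegree_pos, hdom, add_assoc] at hstrict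
  exact hstrict.not_ge (by gcongr)

theorem augmentedValue_mul_le (hφ : IsKeyPolynomial μ φ) (hγ : μ φ ≤ γ) (f g : K[X]) :
    augmentedValue μ φ γ (f * g) ≤ augmentedValue μ φ γ f + augmentedValue μ φ γ g := by
  induction f using expansion_induction hφ.monic hφ.natDegree_pos generalizing g with
  | zero => rw [augmentedValue_zero, top_add]; exact le_top
  | add_mul a f ha ihf =>
    induction g using expansion_induction hφ.monic hφ.natDegree_pos with
    | zero => rw [augmentedValue_zero, add_top]; exact le_top
    | add_mul b g hb ihg =>
      by_cases hfa : augmentedValue μ φ γ (a + φ * f) < μ a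
      · exact hφ.augmentedValue_add_mul_mul_le hγ ha hfa (ihf _)
      by_cases hgb : augmentedValue μ φ γ (b + φ * g) < μ b
      · rw [mul_comm, add_comm (augmentedValue μ φ γ (a + φ * f))]
        exact hφ.augmentedValue_add_mul_mul_le hγ hb hgb
          (by rwa [mul_comm g, add_comm (augmentedValue μ φ γ g)])
      calc augmentedValue μ φ γ ((a + φ * f) * (b + φ * g))
          ≤ μ (((a + φ * f) * (b + φ * g)) %ₘ φ) := by
            simpa [expansionCoeff_zero] using
              augmentedValue_le (μ := μ) (γ := γ) hφ.monic hφ.natDegree_pos _ 0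
        _ = μ a + μ b := by
          rw [mul_modByMonic, add_mul_modByMonic hφ.monic ha, add_mul_modByMonic hφ.monic hb,
            hφ.map_mul_modByMonic_of_degree_lt ha hb]
        _ ≤ _ := add_le_add (not_lt.1 hfa) (not_lt.1 hgb)

/-- Mac Lane's augmented valuation `[μ; φ, γ]`, which replaces the value of the key polynomial `φ`
by `γ ≥ μ φ` and keeps the values of the polynomials of lower degree. -/
def augmentation (hφ : IsKeyPolynomial μ φ) (hγ : μ φ ≤ γ) : AddValuation K[X] (WithTop Λ) :=
  AddValuation.of (augmentedValue μ φ γ) (augmentedValue_zero μ φ γ)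
    (by
      rw [augmentedValue_of_degree_lt hφ.monic hφ.natDegree_pos, μ.map_one]
      exact degree_lt_degree (by simpa using hφ.natDegree_pos))
    (min_le_augmentedValue_add hφ.monic hφ.natDegree_pos)
    fun f g => (hφ.augmentedValue_mul_le hγ f g).antisymm (hφ.augmentedValue_add_le hγ f g)

theorem augmentation_of_degree_lt (hφ : IsKeyPolynomial μ φ) (hγ : μ φ ≤ γ) {a : K[X]}
    (ha : a.degree < φ.degree) : hφ.augmentation hγ a = μ a :=
  augmentedValue_of_degree_lt hφ.monic hφ.natDegree_pos ha

theorem augmentation_C (hφ : IsKeyPolynomial μ φ) (hγ : μ φ ≤ γ) (a : K) :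
    hφ.augmentation hγ (C a) = μ (C a) :=
  hφ.augmentation_of_degree_lt hγ (degree_lt_degree (by simpa using hφ.natDegree_pos))

theorem augmentation_add_mul (hφ : IsKeyPolynomial μ φ) (hγ : μ φ ≤ γ) {a : K[X]}
    (ha : a.degree < φ.degree) (f : K[X]) :
    hφ.augmentation hγ (a + φ * f) = min (μ a) (γ + hφ.augmentation hγ f) :=
  augmentedValue_add_mul hφ.monic hφ.natDegree_pos ha f

theorem augmentation_self (hφ : IsKeyPolynomial μ φ) (hγ : μ φ ≤ γ) :
    hφ.augmentation hγ φ = γ := by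
  simpa using hφ.augmentation_add_mul hγ (a := 0)
    (bot_lt_iff_ne_bot.2 (degree_ne_bot.2 hφ.monic.ne_zero)) 1

theorem map_le_augmentation (hφ : IsKeyPolynomial μ φ) (hγ : μ φ ≤ γ) (f : K[X]) :
    μ f ≤ hφ.augmentation hγ f :=
  hφ.map_le_augmentedValue hγ f

theorem augmentation_le (hφ : IsKeyPolynomial μ φ) (hγ : μ φ ≤ γ) (f : K[X]) (s : ℕ) :
    hφ.augmentation hγ f ≤ μ (expansionCoeff φ f s) + s • γ :=
  augmentedValue_le hφ.monic hφ.natDegree_pos f s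

theorem augmentation_le_map_modByMonic (hφ : IsKeyPolynomial μ φ) (hγ : μ φ ≤ γ) (f : K[X]) :
    hφ.augmentation hγ f ≤ μ (f %ₘ φ) := by
  simpa [expansionCoeff_zero] using hφ.augmentation_le hγ f 0

theorem augmentation_top (hφ : IsKeyPolynomial μ φ) (f : K[X]) :
    hφ.augmentation le_top f = μ (f %ₘ φ) := by
  nth_rewrite 1 [← modByMonic_add_div f φ]
  rw [hφ.augmentation_add_mul le_top (degree_modByMonic_lt f hφ.monic), top_add, min_top_right]

theorem natDegree_nsmul_augmentation_le (hφ : IsKeyPolynomial μ φ) (hγ : μ φ ≤ γ) {f : K[X]}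
    (hf : f.Monic) : φ.natDegree • hφ.augmentation hγ f ≤ f.natDegree • γ := by
  have hlead : expansionCoeff φ (f ^ φ.natDegree) f.natDegree = 1 :=
    expansionCoeff_eq_one hφ.monic hφ.natDegree_pos (hf.pow _) (by rw [natDegree_pow, mul_comm])
  simpa [hlead] using hφ.augmentation_le hγ (f ^ φ.natDegree) f.natDegree

theorem natDegree_nsmul_map_le (hφ : IsKeyPolynomial μ φ) {f : K[X]} (hf : f.Monic) :
    φ.natDegree • μ f ≤ f.natDegree • μ φ :=
  (nsmul_le_nsmul_right (hφ.map_le_augmentation le_rfl f) _).trans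
    (hφ.natDegree_nsmul_augmentation_le le_rfl hf)

end IsKeyPolynomial

end Augmentation

end KeyPolynomial

section Conjugation

variable {Λ : Type w} [AddCommGroup Λ] [LinearOrder Λ] [IsOrderedAddMonoid Λ]

/-- Otherwise the iterates `σ^[k] x` would be infinitely many conjugates of `x`. -/
theorem not_map_lt_map_algEquiv {K A : Type*} [Field K] [Field A] [Algebra K A]
    [Algebra.IsAlgebraic K A] {w : AddValuation A (WithTop Λ)} {σ : A ≃ₐ[K] A}
    (hσ : (w.comap (σ : A →+* A)).IsEquiv w) (x : A) : ¬ w x < w (σ x) := by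
  intro hlt
  have hstep (k : ℕ) : w (σ^[k] x) < w (σ^[k + 1] x) := by
    induction k with
    | zero => exact hlt
    | succ k ih =>
      rw [Function.iterate_succ_apply', Function.iterate_succ_apply']
      exact lt_of_not_ge fun h => ih.not_ge ((hσ _ _).1 h)
  have hinj : Function.Injective fun k : ℕ => σ^[k] x :=
    (strictMono_nat_of_lt_succ hstep).injective.of_comp (f := w)
  have hroot (k : ℕ) : σ^[k] x ∈ (minpoly K x).rootSet A := by
    rw [mem_rootSet_of_ne (minpoly.ne_zero (Algebra.IsIntegral.isIntegral x))]
    induction k with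
    | zero => exact minpoly.aeval K x
    | succ k ih => rw [Function.iterate_succ_apply', aeval_algHom_apply, ih, map_zero]
  exact Set.infinite_of_injective_forall_mem hinj hroot (rootSet_finite _ A)

theorem IsHenselian.isEquiv_comap_algEquiv {K : Type u} [Field K] {v : AddValuation K (WithTop Λ)}
    (hv : IsHenselian v) {w : AddValuation (AlgebraicClosure K) (WithTop Λ)}
    (hw : ∀ a : K, w (algebraMap K (AlgebraicClosure K) a) = v a)
    (σ : AlgebraicClosure K ≃ₐ[K] AlgebraicClosure K) :
    (w.comap (σ : AlgebraicClosure K →+* AlgebraicClosure K)).IsEquiv w := by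
  refine (Valuation.isEquiv_iff_valuationSubring _ _).2 (hv.unique (fun a => ?_) fun a => ?_)
  · change 0 ≤ w (σ (algebraMap K _ a)) ↔ _
    rw [σ.commutes, hw]
  · change 0 ≤ w (algebraMap K _ a) ↔ _
    rw [hw]

theorem IsHenselian.map_algEquiv {K : Type u} [Field K] {v : AddValuation K (WithTop Λ)}
    (hv : IsHenselian v) {w : AddValuation (AlgebraicClosure K) (WithTop Λ)}
    (hw : ∀ a : K, w (algebraMap K (AlgebraicClosure K) a) = v a)
    (σ : AlgebraicClosure K ≃ₐ[K] AlgebraicClosure K) (x : AlgebraicClosure K) :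
    w (σ x) = w x := by
  refine le_antisymm (not_lt.1 (not_map_lt_map_algEquiv (hv.isEquiv_comap_algEquiv hw σ) x)) ?_
  simpa using not_map_lt_map_algEquiv (hv.isEquiv_comap_algEquiv hw σ.symm) (σ x)

end Conjugation

section Conjugates

variable {A Γ : Type*} [CommRing A] [LinearOrderedAddCommMonoidWithTop Γ] {w : AddValuation A Γ}

theorem map_multiset_prod_eq_card_nsmul {δ : Γ} {s : Multiset A} (hs : ∀ x ∈ s, w x = δ) :
    w s.prod = s.card • δ := by
  induction s using Multiset.induction_on with
  | empty => simp
  | cons x s ih =>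
    rw [Multiset.prod_cons, w.map_mul, hs x (Multiset.mem_cons_self x s),
      ih fun y hy => hs y (Multiset.mem_cons_of_mem hy), Multiset.card_cons, succ_nsmul']

theorem card_nsmul_le_map_coeff_prod_X_sub_C {δ : Γ} {s : Multiset A} (hs : ∀ x ∈ s, δ ≤ w x)
    (j : ℕ) : s.card • δ ≤ w ((s.map fun x => X - C x).prod.coeff j) + j • δ := by
  induction s using Multiset.induction_on generalizing j with
  | empty =>
    cases j with
    | zero => simp
    | succ j => simp [coeff_one]
  | cons x s ih =>
    have hx : δ ≤ w x := hs x (Multiset.mem_cons_self x s)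
    have ih' := ih fun y hy => hs y (Multiset.mem_cons_of_mem hy)
    rw [Multiset.map_cons, Multiset.prod_cons, Multiset.card_cons, succ_nsmul', sub_mul]
    cases j with
    | zero =>
      rw [coeff_sub, coeff_X_mul_zero, coeff_C_mul, zero_sub, w.map_neg, w.map_mul, add_assoc]
      exact add_le_add hx (ih' 0)
    | succ j =>
      rw [coeff_sub, coeff_X_mul, coeff_C_mul]
      refine le_trans ?_ (add_le_add_left (w.map_sub _ _) _)
      rw [← min_add_add_right]
      refine le_min ?_ ?_
      · rw [succ_nsmul', add_left_comm]
        gcongr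
        exact ih' j
      · rw [w.map_mul, add_assoc]
        exact add_le_add hx (ih' (j + 1))

end Conjugates

section Minpoly

variable {K A Γ : Type*} [Field K] [Field A] [Algebra K A] [Normal K A]
variable [LinearOrderedAddCommMonoidWithTop Γ] {w : AddValuation A Γ}

theorem map_eq_of_mem_aroots_minpoly (hw : ∀ (σ : A ≃ₐ[K] A) x, w (σ x) = w x) {β x : A}
    (hx : x ∈ (minpoly K β).aroots A) : w x = w β := by
  obtain ⟨σ, rfl⟩ := minpoly.exists_algEquiv_of_root'
    (Algebra.IsIntegral.isIntegral (R := K) β).isAlgebraic (mem_aroots.1 hx).2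
  exact hw σ β

theorem card_aroots_minpoly (β : A) :
    ((minpoly K β).aroots A).card = (minpoly K β).natDegree := by
  rw [← (Normal.splits ‹_› β).natDegree_eq_card_roots, natDegree_map]

theorem map_algebraMap_coeff_zero_minpoly (hw : ∀ (σ : A ≃ₐ[K] A) x, w (σ x) = w x) (β : A) :
    w (algebraMap K A ((minpoly K β).coeff 0)) = (minpoly K β).natDegree • w β := by
  have hmonic := minpoly.monic (Algebra.IsIntegral.isIntegral (R := K) β)
  rw [← coeff_map, (Normal.splits ‹_› β).coeff_zero_eq_prod_roots_of_monic (hmonic.map _),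
    w.map_mul, map_multiset_prod_eq_card_nsmul fun x hx => map_eq_of_mem_aroots_minpoly hw hx,
    card_aroots_minpoly, w.map_pow, w.map_neg, w.map_one, nsmul_zero, zero_add]

theorem natDegree_nsmul_le_map_coeff_minpoly (hw : ∀ (σ : A ≃ₐ[K] A) x, w (σ x) = w x) (β : A)
    (j : ℕ) : (minpoly K β).natDegree • w β ≤
      w (algebraMap K A ((minpoly K β).coeff j)) + j • w β := by
  have hmonic := minpoly.monic (Algebra.IsIntegral.isIntegral (R := K) β)
  rw [← coeff_map, (Normal.splits ‹_› β).eq_prod_roots_of_monic (hmonic.map _),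
    ← card_aroots_minpoly β]
  exact card_nsmul_le_map_coeff_prod_X_sub_C
    (fun x hx => (map_eq_of_mem_aroots_minpoly hw hx).ge) j

end Minpoly

section Composition

variable {R Γ : Type*} [CommRing R] [LinearOrderedAddCommMonoidWithTop Γ]

theorem le_map_comp {ω : AddValuation R[X] Γ} {p φ : R[X]} {c δ : Γ}
    (hp : ∀ j, c ≤ ω (C (p.coeff j)) + j • δ) (hφ : δ ≤ ω φ) : c ≤ ω (p.comp φ) := by
  rw [comp_eq_sum_left, sum_def]
  refine ω.map_le_sum fun j _ => ?_
  rw [ω.map_mul, ω.map_pow]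
  exact (hp j).trans (by gcongr)

theorem comp_modByMonic {φ : R[X]} (hφ : φ.Monic) (hdeg : 0 < φ.natDegree) (p : R[X]) :
    p.comp φ %ₘ φ = C (p.coeff 0) := by
  nth_rewrite 1 [← divX_mul_X_add p]
  rw [add_comp, mul_comp, X_comp, C_comp, add_comm, mul_comm, add_mul_modByMonic hφ]
  exact degree_lt_degree (by simpa using hdeg)

variable {K A : Type*} [Field K] [Ring A] [Nontrivial A] [Algebra K A]

theorem dvd_minpoly_comp {F : K[X]} (hF : F.Monic) (hFirr : Irreducible F) {θ : A}
    (hθ : aeval θ F = 0) (φ : K[X]) : F ∣ (minpoly K (aeval θ φ)).comp φ := by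
  rw [minpoly.eq_of_irreducible_of_monic hFirr hθ hF]
  exact minpoly.dvd K θ (by rw [aeval_comp, minpoly.aeval])

theorem aeval_eq_zero_iff_eq {F φ : K[X]} (hF : F.Monic) (hFirr : Irreducible F) (hφ : φ.Monic)
    (hφirr : Irreducible φ) {θ : A} (hθ : aeval θ F = 0) : aeval θ φ = 0 ↔ F = φ := by
  refine ⟨fun h => ?_, fun h => h ▸ hθ⟩
  rw [minpoly.eq_of_irreducible_of_monic hFirr hθ hF,
    minpoly.eq_of_irreducible_of_monic hφirr h hφ]

end Composition

section Squeeze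

variable {Λ : Type w} [AddCommGroup Λ] [LinearOrder Λ] [IsOrderedAddMonoid Λ]

theorem map_eq_map_of_dvd_of_le {R : Type*} [Ring R] {ω ρ : AddValuation R (WithTop Λ)}
    (hle : ∀ f, ω f ≤ ρ f) {F G : R} (hFG : F ∣ G) (hG : ρ G ≤ ω G) (hGtop : ω G ≠ ⊤) :
    ω F = ρ F := by
  obtain ⟨H, rfl⟩ := hFG
  rw [ω.map_mul] at hG hGtop
  rw [ρ.map_mul] at hG
  refine (hle F).antisymm (not_lt.1 fun hlt => hG.not_gt ?_)
  exact WithTop.add_lt_add_of_lt_of_le (WithTop.add_ne_top.1 hGtop).2 hlt (hle H)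

variable {K A : Type*} [Field K] [Field A] [Algebra K A] [Normal K A]
variable {w : AddValuation A (WithTop Λ)} {μ ω : AddValuation K[X] (WithTop Λ)} {φ : K[X]}

theorem natDegree_nsmul_le_map_minpoly_comp (hw : ∀ (σ : A ≃ₐ[K] A) x, w (σ x) = w x)
    (hω : ∀ a : K, ω (C a) = w (algebraMap K A a)) {β : A} (hβ : w β ≤ ω φ) :
    (minpoly K β).natDegree • w β ≤ ω ((minpoly K β).comp φ) :=
  le_map_comp (fun j => by rw [hω]; exact natDegree_nsmul_le_map_coeff_minpoly hw β j) hβ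

namespace IsKeyPolynomial

theorem map_minpoly_comp_modByMonic (hφ : IsKeyPolynomial μ φ)
    (hw : ∀ (σ : A ≃ₐ[K] A) x, w (σ x) = w x)
    (hμ : ∀ a : K, μ (C a) = w (algebraMap K A a)) (β : A) :
    μ ((minpoly K β).comp φ %ₘ φ) = (minpoly K β).natDegree • w β := by
  rw [comp_modByMonic hφ.monic hφ.natDegree_pos, hμ, map_algebraMap_coeff_zero_minpoly hw]

/-- Between `ω` and `f ↦ μ (f %ₘ φ)` there is no room left on the multiple `g.comp φ` of `F`, where
`g` is the minimal polynomial of `φ(θ)`, hence none on `F` either. -/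
theorem map_eq_map_modByMonic (hφ : IsKeyPolynomial μ φ)
    (hw : ∀ (σ : A ≃ₐ[K] A) x, w (σ x) = w x)
    (hμ : ∀ a : K, μ (C a) = w (algebraMap K A a)) (hωC : ∀ a, ω (C a) = μ (C a))
    (hω : ∀ f, ω f ≤ μ (f %ₘ φ)) {F : K[X]} (hF : F.Monic) (hFirr : Irreducible F) {θ : A}
    (hθ : aeval θ F = 0) (hθφ : aeval θ φ ≠ 0) (hle : w (aeval θ φ) ≤ ω φ) :
    ω F = μ (F %ₘ φ) := by
  set g := minpoly K (aeval θ φ)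
  have hmod : μ (g.comp φ %ₘ φ) = g.natDegree • w (aeval θ φ) :=
    hφ.map_minpoly_comp_modByMonic hw hμ _
  have hge : g.natDegree • w (aeval θ φ) ≤ ω (g.comp φ) :=
    natDegree_nsmul_le_map_minpoly_comp hw (fun a => (hωC a).trans (hμ a)) hle
  have hne : μ (g.comp φ %ₘ φ) ≠ ⊤ := by
    rw [hmod, ← w.map_pow]
    exact w.ne_top_iff.2 (pow_ne_zero _ hθφ)
  simp_rw [← hφ.augmentation_top] at hω hmod hne ⊢
  exact map_eq_map_of_dvd_of_le hω (dvd_minpoly_comp hF hFirr hθ φ) (hmod.trans_le hge)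
    ((hω _).trans_lt hne.lt_top).ne

theorem not_muDvd_of_map_aeval_le (hφ : IsKeyPolynomial μ φ)
    (hw : ∀ (σ : A ≃ₐ[K] A) x, w (σ x) = w x)
    (hμ : ∀ a : K, μ (C a) = w (algebraMap K A a)) {F : K[X]} (hF : F.Monic)
    (hFirr : Irreducible F) {θ : A} (hθ : aeval θ F = 0) (hle : w (aeval θ φ) ≤ μ φ) :
    ¬ MuDvd μ φ F := by
  have hθφ : aeval θ φ ≠ 0 := w.ne_top_iff.1 (hle.trans_lt hφ.map_ne_top.lt_top).ne
  rw [hφ.muDvd_iff hF.ne_zero, not_lt]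
  exact (hφ.map_eq_map_modByMonic hw hμ (fun _ => rfl) hφ.map_le_map_modByMonic hF hFirr hθ hθφ
    hle).ge

variable {γ : Λ}

theorem natDegree_nsmul_augmentation_eq_of_dvd (hφ : IsKeyPolynomial μ φ) (hγ : μ φ ≤ γ)
    {F G : K[X]} (hF : F.Monic) (hG : G.Monic) (hFG : F ∣ G)
    (hle : G.natDegree • (γ : WithTop Λ) ≤ φ.natDegree • hφ.augmentation hγ G) :
    φ.natDegree • hφ.augmentation hγ F = F.natDegree • (γ : WithTop Λ) := by
  obtain ⟨H, rfl⟩ := hFG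
  have hH : H.Monic := hF.of_mul_monic_left hG
  refine (hφ.natDegree_nsmul_augmentation_le hγ hF).antisymm (not_lt.1 fun hlt => hle.not_gt ?_)
  rw [hF.natDegree_mul hH, add_nsmul, (hφ.augmentation hγ).map_mul, nsmul_add,
    ← WithTop.coe_nsmul γ H.natDegree]
  refine WithTop.add_lt_add_of_lt_of_le ?_ hlt ?_
  · exact ((hφ.natDegree_nsmul_augmentation_le hγ hH).trans_lt (WithTop.coe_lt_top _)).ne
  · exact hφ.natDegree_nsmul_augmentation_le hγ hH

theorem natDegree_nsmul_augmentation_eq (hφ : IsKeyPolynomial μ φ) (hγ : μ φ ≤ γ)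
    (hw : ∀ (σ : A ≃ₐ[K] A) x, w (σ x) = w x)
    (hμ : ∀ a : K, μ (C a) = w (algebraMap K A a)) {F : K[X]} (hF : F.Monic)
    (hFirr : Irreducible F) {θ : A} (hθ : aeval θ F = 0) (hθγ : w (aeval θ φ) = γ) :
    φ.natDegree • hφ.augmentation hγ F = F.natDegree • (γ : WithTop Λ) := by
  have hge := natDegree_nsmul_le_map_minpoly_comp hw (ω := hφ.augmentation hγ)
    (fun a => (hφ.augmentation_C hγ a).trans (hμ a)) (hθγ.le.trans (hφ.augmentation_self hγ).ge)
  refine hφ.natDegree_nsmul_augmentation_eq_of_dvd hγ hF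
    ((minpoly.monic (Algebra.IsIntegral.isIntegral _)).comp hφ.monic hφ.natDegree_pos.ne')
    (dvd_minpoly_comp hF hFirr hθ φ) ?_
  rw [natDegree_comp, mul_nsmul]
  exact nsmul_le_nsmul_right (by rwa [hθγ] at hge) _

/-- The polynomial `f` satisfies `f.natDegree = l * φ.natDegree + r` with `r < φ.natDegree`, and a
remainder `r > 0` would make the coefficient of `φ ^ l` in `f` too small. -/
theorem natDegree_dvd_natDegree (hφ : IsKeyPolynomial μ φ) (hγ : μ φ < γ) {f : K[X]}
    (hf : f.Monic)
    (hfγ : φ.natDegree • hφ.augmentation hγ.le f = f.natDegree • (γ : WithTop Λ)) :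
    φ.natDegree ∣ f.natDegree := by
  set m := φ.natDegree
  set l := f.natDegree / m
  set r := f.natDegree % m
  have hsplit : f.natDegree = r + m * l := (Nat.mod_add_div _ _).symm
  have hφl : (φ ^ l).natDegree = m * l := by rw [natDegree_pow, mul_comm]
  have ha : (f /ₘ φ ^ l).Monic := by
    rw [Monic, leadingCoeff_divByMonic_of_monic (hφ.monic.pow l), hf.leadingCoeff]
    rw [degree_eq_natDegree (hφ.monic.pow l).ne_zero, degree_eq_natDegree hf.ne_zero, hφl]
    exact_mod_cast Nat.mul_div_le _ _
  have hadeg : (f /ₘ φ ^ l).natDegree = r := by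
    rw [natDegree_divByMonic _ (hφ.monic.pow l), hφl, hsplit, Nat.add_sub_cancel]
  have hcoeff : expansionCoeff φ f l = f /ₘ φ ^ l := (modByMonic_eq_self_iff hφ.monic).2
    (degree_lt_degree (hadeg.trans_lt (Nat.mod_lt _ hφ.natDegree_pos)))
  have hγφ : r • (γ : WithTop Λ) ≤ r • μ φ := by
    have hle : f.natDegree • (γ : WithTop Λ) ≤ m • (μ (f /ₘ φ ^ l) + l • (γ : WithTop Λ)) := by
      rw [← hfγ, ← hcoeff]
      exact nsmul_le_nsmul_right (hφ.augmentation_le hγ.le f l) m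
    rw [nsmul_add, ← mul_nsmul', hsplit, add_nsmul, ← WithTop.coe_nsmul γ (m * l)] at hle
    exact (WithTop.le_of_add_le_add_right WithTop.coe_ne_top hle).trans
      (hadeg ▸ hφ.natDegree_nsmul_map_le ha)
  refine Nat.dvd_of_mod_eq_zero (not_not.1 fun hr => hγφ.not_gt ?_)
  obtain ⟨c, hc⟩ := WithTop.ne_top_iff_exists.1 hφ.map_ne_top
  rw [← hc] at hγ ⊢
  norm_cast at hγ ⊢
  exact nsmul_lt_nsmul_right hr hγ

theorem augmentation_eq_div_nsmul (hφ : IsKeyPolynomial μ φ) (hγ : μ φ < γ) {f : K[X]}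
    (hf : f.Monic)
    (hfγ : φ.natDegree • hφ.augmentation hγ.le f = f.natDegree • (γ : WithTop Λ)) :
    hφ.augmentation hγ.le f = (f.natDegree / φ.natDegree) • (γ : WithTop Λ) := by
  obtain ⟨l, hl⟩ := hφ.natDegree_dvd_natDegree hγ hf hfγ
  rw [hl, mul_nsmul', ← WithTop.coe_nsmul, ← WithTop.coe_nsmul] at hfγ
  rw [hl, Nat.mul_div_cancel_left l hφ.natDegree_pos]
  cases hω : hφ.augmentation hγ.le f with
  | top =>
    rw [hω, ← Nat.succ_pred_eq_of_pos hφ.natDegree_pos, succ_nsmul, add_top] at hfγ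
    exact absurd hfγ WithTop.top_ne_coe
  | coe c =>
    rw [hω] at hfγ
    norm_cast at hfγ ⊢
    exact nsmul_right_injective hφ.natDegree_pos.ne' hfγ

theorem nsmul_lt_map (hφ : IsKeyPolynomial μ φ) (hγ : μ φ < γ) {l : ℕ} {R : K[X]}
    (hdeg : R.degree < (φ ^ l).degree)
    (hle : l • (γ : WithTop Λ) ≤ hφ.augmentation hγ.le R) : l • μ φ < μ R := by
  induction l generalizing R with
  | zero =>
    have hR : R = 0 := by simpa [degree_one, degree_eq_bot] using hdeg
    simp [hR]
  | succ l ih =>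
    obtain ⟨c, hc⟩ := WithTop.ne_top_iff_exists.1 hφ.map_ne_top
    rw [← divByMonic_eq_zero_iff (hφ.monic.pow _), pow_succ', divByMonic_mul hφ.monic
      (hφ.monic.pow l), divByMonic_eq_zero_iff (hφ.monic.pow l)] at hdeg
    rw [← modByMonic_add_div R φ] at hle ⊢
    rw [hφ.augmentation_add_mul _ (degree_modByMonic_lt R hφ.monic), le_min_iff, succ_nsmul',
      WithTop.add_le_add_iff_left WithTop.coe_ne_top, ← succ_nsmul'] at hle
    refine μ.map_lt_add (lt_of_lt_of_le ?_ hle.1) ?_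
    · rw [← hc] at hγ ⊢
      norm_cast at hγ ⊢
      exact nsmul_lt_nsmul_right l.succ_ne_zero hγ
    · rw [μ.map_mul, succ_nsmul']
      exact WithTop.add_lt_add_left hφ.map_ne_top (ih hdeg hle.2)

theorem muEquiv_pow (hφ : IsKeyPolynomial μ φ) (hγ : μ φ < γ) {f : K[X]} (hf : f.Monic)
    (hfγ : φ.natDegree • hφ.augmentation hγ.le f = f.natDegree • (γ : WithTop Λ)) :
    MuEquiv μ f (φ ^ (f.natDegree / φ.natDegree)) := by
  refine Eq.symm (muEquiv_of_lt ?_)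
  rw [μ.map_pow]
  refine hφ.nsmul_lt_map hγ (degree_sub_lt_of_monic hf (hφ.monic.pow _) ?_) ?_
  · rw [natDegree_pow, Nat.div_mul_cancel (hφ.natDegree_dvd_natDegree hγ hf hfγ)]
  · refine (hφ.augmentation hγ.le).map_le_sub (hφ.augmentation_eq_div_nsmul hγ hf hfγ).ge ?_
    rw [(hφ.augmentation hγ.le).map_pow, hφ.augmentation_self]

theorem muDvd_of_lt_map_aeval (hφ : IsKeyPolynomial μ φ)
    (hw : ∀ (σ : A ≃ₐ[K] A) x, w (σ x) = w x)
    (hμ : ∀ a : K, μ (C a) = w (algebraMap K A a)) {F : K[X]} (hF : F.Monic)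
    (hFirr : Irreducible F) {θ : A} (hθ : aeval θ F = 0) (hlt : μ φ < w (aeval θ φ)) :
    MuDvd μ φ F := by
  rcases eq_or_ne F φ with rfl | hne
  · exact dvd_rfl
  · obtain ⟨γ, hγ⟩ := WithTop.ne_top_iff_exists.1 (w.ne_top_iff.2 (mt
      (aeval_eq_zero_iff_eq hF hFirr hφ.monic hφ.irreducible_polynomial hθ).1 hne))
    rw [← hγ] at hlt
    have hFγ := hφ.natDegree_nsmul_augmentation_eq hlt.le hw hμ hF hFirr hθ hγ.symm
    have hdvd := hφ.natDegree_dvd_natDegree hlt hF hFγ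
    exact (hφ.muEquiv_pow hlt hF hFγ).muDvd_of_dvd
      (dvd_pow_self φ (Nat.div_ne_zero_iff_of_dvd hdvd |>.2
        ⟨hFirr.natDegree_pos.ne', hφ.natDegree_pos.ne'⟩))

theorem muDvd_iff_lt_map_aeval (hφ : IsKeyPolynomial μ φ)
    (hw : ∀ (σ : A ≃ₐ[K] A) x, w (σ x) = w x)
    (hμ : ∀ a : K, μ (C a) = w (algebraMap K A a)) {F : K[X]} (hF : F.Monic)
    (hFirr : Irreducible F) {θ : A} (hθ : aeval θ F = 0) :
    MuDvd μ φ F ↔ μ φ < w (aeval θ φ) :=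
  ⟨fun h => not_le.1 fun hle => hφ.not_muDvd_of_map_aeval_le hw hμ hF hFirr hθ hle h,
    hφ.muDvd_of_lt_map_aeval hw hμ hF hFirr hθ⟩

end IsKeyPolynomial

end Squeeze

section LowerBoundary

variable {Λ : Type w} [AddCommGroup Λ] [Module ℚ Λ]

theorem mem_segment_iff_of_slope {Y γ : Λ} {l : ℕ} (hl : 0 < l) {p : ℚ × Λ} :
    p ∈ segment ℚ ((0 : ℚ), Y) ((l : ℚ), Y + l • (-γ)) ↔
      0 ≤ p.1 ∧ p.1 ≤ l ∧ p.2 + p.1 • γ = Y := by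
  have hl' : (0 : ℚ) < l := by exact_mod_cast hl
  have hpoint (t : ℚ) : (1 - t) • ((0 : ℚ), Y) + t • ((l : ℚ), Y + l • (-γ)) =
      (t * l, Y - (t * l) • γ) := by
    ext
    · simp
    · simp only [Prod.snd_add, Prod.smul_snd, ← Nat.cast_smul_eq_nsmul ℚ]
      module
  simp only [segment_eq_image, hpoint, Set.mem_image, Set.mem_Icc]
  constructor
  · rintro ⟨t, ⟨h0, h1⟩, rfl⟩
    exact ⟨by positivity, mul_le_of_le_one_left hl'.le h1, sub_add_cancel _ _⟩
  · rintro ⟨h0, h1, h2⟩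
    refine ⟨p.1 / l, ⟨by positivity, (div_le_one hl').2 h1⟩, ?_⟩
    rw [div_mul_cancel₀ _ hl'.ne', ← h2, add_sub_cancel_right]

variable [LinearOrder Λ] [IsOrderedAddMonoid Λ]

theorem rat_smul_le_smul {q : ℚ} (hq : 0 ≤ q) {x y : Λ} (hxy : x ≤ y) : q • x ≤ q • y := by
  have hden (z : Λ) : q.den • (q • z) = q.num.toNat • z := by
    rw [← Nat.cast_smul_eq_nsmul ℚ, ← Nat.cast_smul_eq_nsmul ℚ, smul_smul, mul_comm,
      Rat.mul_den_eq_num]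
    congr 1
    exact_mod_cast (Int.toNat_of_nonneg (Rat.num_nonneg.2 hq)).symm
  rw [← nsmul_le_nsmul_iff_right q.den_ne_zero, hden, hden]
  gcongr

theorem convex_setOf_le_add_smul (l : ℚ) (Y γ : Λ) :
    Convex ℚ {p : ℚ × Λ | 0 ≤ p.1 ∧ p.1 ≤ l ∧ Y ≤ p.2 + p.1 • γ} := by
  rintro x ⟨hx0, hx1, hx2⟩ y ⟨hy0, hy1, hy2⟩ a b ha hb hab
  refine ⟨add_nonneg (mul_nonneg ha hx0) (mul_nonneg hb hy0), ?_, ?_⟩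
  · exact convex_Iic l hx1 hy1 ha hb hab
  · calc Y = a • Y + b • Y := by rw [← add_smul, hab, one_smul]
      _ ≤ a • (x.2 + x.1 • γ) + b • (y.2 + y.1 • γ) :=
        add_le_add (rat_smul_le_smul ha hx2) (rat_smul_le_smul hb hy2)
      _ = (a • x + b • y).2 + (a • x + b • y).1 • γ := by
        simp only [Prod.fst_add, Prod.smul_fst, Prod.snd_add, Prod.smul_snd, smul_eq_mul]
        module

theorem lowerBoundary_eq_segment {S : Set (ℚ × Λ)} {Y γ : Λ} {l : ℕ} (hl : 0 < l)
    (h0 : ((0 : ℚ), Y) ∈ S) (h1 : ((l : ℚ), Y + l • (-γ)) ∈ S)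
    (hS : ∀ p ∈ S, 0 ≤ p.1 ∧ p.1 ≤ l ∧ Y ≤ p.2 + p.1 • γ) :
    {p : ℚ × Λ | p ∈ convexHull ℚ S ∧ ∀ y : Λ, (p.1, y) ∈ convexHull ℚ S → p.2 ≤ y} =
      segment ℚ ((0 : ℚ), Y) ((l : ℚ), Y + l • (-γ)) := by
  have hseg := segment_subset_convexHull (𝕜 := ℚ) h0 h1
  have hhull := convexHull_min hS (convex_setOf_le_add_smul l Y γ)
  ext p
  rw [mem_segment_iff_of_slope hl]
  constructor
  · rintro ⟨hp, hmin⟩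
    obtain ⟨hp0, hp1, hp2⟩ := hhull hp
    have hle : p.2 ≤ Y - p.1 • γ :=
      hmin _ (hseg ((mem_segment_iff_of_slope hl).2 ⟨hp0, hp1, sub_add_cancel _ _⟩))
    exact ⟨hp0, hp1, (le_sub_iff_add_le.1 hle).antisymm hp2⟩
  · rintro ⟨hp0, hp1, hp2⟩
    refine ⟨hseg ((mem_segment_iff_of_slope hl).2 ⟨hp0, hp1, hp2⟩), fun y hy => ?_⟩
    have hle : p.2 + p.1 • γ ≤ y + p.1 • γ := hp2.trans_le (hhull hy).2.2
    exact le_of_add_le_add_right hle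

end LowerBoundary

section NewtonPolygon

variable {K : Type u} [Field K]
variable {Λ : Type w} [AddCommGroup Λ] [LinearOrder Λ] [IsOrderedAddMonoid Λ] [Module ℚ Λ]
variable {μ : AddValuation K[X] (WithTop Λ)} {φ : K[X]}

namespace IsKeyPolynomial

theorem isOneSided_newtonPolygon_of_nsmul_le (hφ : IsKeyPolynomial μ φ) {γ : Λ}
    (hγ : μ φ ≤ γ) {f : K[X]} (hf : f.Monic) {l : ℕ} (hl : 0 < l)
    (hdeg : f.natDegree = l * φ.natDegree) (hle : l • (γ : WithTop Λ) ≤ hφ.augmentation hγ f)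
    (hmod : μ (f %ₘ φ) = l • (γ : WithTop Λ)) : IsOneSided (newtonPolygon μ φ f) (-γ) := by
  refine ⟨l • γ, l, hl, lowerBoundary_eq_segment hl ⟨0, by simp, ?_⟩ ⟨l, rfl, ?_⟩ ?_⟩
  · rw [expansionCoeff_zero, hmod, WithTop.coe_nsmul]
  · rw [expansionCoeff_eq_one hφ.monic hφ.natDegree_pos hf hdeg, μ.map_one, smul_neg,
      add_neg_cancel, WithTop.coe_zero]
  · rintro ⟨_, b⟩ ⟨s, rfl, hb : (b : WithTop Λ) = _⟩
    have hs : s ≤ l := by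
      by_contra! hlt
      rw [expansionCoeff_eq_zero hφ.monic, μ.map_zero] at hb
      · exact WithTop.coe_ne_top hb
      · exact hdeg.trans_lt (Nat.mul_lt_mul_of_pos_right hlt hφ.natDegree_pos)
    have habove : l • (γ : WithTop Λ) ≤ b + s • (γ : WithTop Λ) :=
      hb ▸ hle.trans (hφ.augmentation_le hγ f s)
    refine ⟨Nat.cast_nonneg s, Nat.cast_le.2 hs, ?_⟩
    rw [Nat.cast_smul_eq_nsmul]
    exact_mod_cast habove

theorem isOneSided_newtonPolygon {A : Type*} [Field A] [Algebra K A] [Normal K A]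
    {w : AddValuation A (WithTop Λ)} (hφ : IsKeyPolynomial μ φ)
    (hw : ∀ (σ : A ≃ₐ[K] A) x, w (σ x) = w x)
    (hμ : ∀ a : K, μ (C a) = w (algebraMap K A a)) {F : K[X]} (hF : F.Monic)
    (hFirr : Irreducible F) {θ : A} (hθ : aeval θ F = 0) {γ : Λ} (hγ : μ φ < γ)
    (hθγ : w (aeval θ φ) = γ) : IsOneSided (newtonPolygon μ φ F) (-γ) := by
  have hFγ := hφ.natDegree_nsmul_augmentation_eq hγ.le hw hμ hF hFirr hθ hθγ
  have hval := hφ.augmentation_eq_div_nsmul hγ hF hFγ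
  have hdvd := hφ.natDegree_dvd_natDegree hγ hF hFγ
  have hmod : hφ.augmentation hγ.le F = μ (F %ₘ φ) :=
    hφ.map_eq_map_modByMonic hw hμ (hφ.augmentation_C hγ.le)
      (hφ.augmentation_le_map_modByMonic hγ.le) hF hFirr hθ
      (w.ne_top_iff.1 (hθγ ▸ WithTop.coe_ne_top)) (hθγ.trans_le (hφ.augmentation_self hγ.le).ge)
  exact hφ.isOneSided_newtonPolygon_of_nsmul_le hγ.le hF
    (Nat.div_pos (Nat.le_of_dvd hFirr.natDegree_pos hdvd) hφ.natDegree_pos)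
    (Nat.div_mul_cancel hdvd).symm hval.ge (hmod.symm.trans hval)

end IsKeyPolynomial

end NewtonPolygon

end ValTree

end

theorem mainTheorem9_general {K A : Type*} [Field K] [Field A] [Algebra K A] [Normal K A]
    {Λ : Type*} [AddCommGroup Λ] [LinearOrder Λ] [IsOrderedAddMonoid Λ] [Module ℚ Λ]
    {w : AddValuation A (WithTop Λ)} (hw : ∀ (σ : A ≃ₐ[K] A) x, w (σ x) = w x)
    {F : K[X]} (hF : F.Monic) (hFirr : Irreducible F) {θ : A} (hθ : aeval θ F = 0)
    {μ : AddValuation K[X] (WithTop Λ)} (hμ : ∀ a : K, μ (C a) = w (algebraMap K A a))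
    {φ : K[X]} (hφ : ValTree.IsKeyPolynomial μ φ) :
    (ValTree.MuDvd μ φ F ↔ μ φ < w (aeval θ φ)) ∧
    (ValTree.MuDvd μ φ F →
      (F = φ ∨ ∃ γ : Λ, (γ : WithTop Λ) = w (aeval θ φ) ∧
        ValTree.IsOneSided (ValTree.newtonPolygon μ φ F) (-γ)) ∧
      (φ.natDegree ∣ F.natDegree ∧
        ValTree.MuEquiv μ F (φ ^ (F.natDegree / φ.natDegree)))) := by
  have hiff : ValTree.MuDvd μ φ F ↔ μ φ < w (aeval θ φ) :=
    hφ.muDvd_iff_lt_map_aeval hw hμ hF hFirr hθ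
  refine ⟨hiff, fun hdvd => ?_⟩
  rcases eq_or_ne F φ with rfl | hne
  · refine ⟨.inl rfl, dvd_rfl, ?_⟩
    rw [Nat.div_self hφ.natDegree_pos, pow_one, ValTree.MuEquiv]
  · have hθφ : aeval θ φ ≠ 0 := mt
      (ValTree.aeval_eq_zero_iff_eq hF hFirr hφ.monic hφ.irreducible_polynomial hθ).1 hne
    obtain ⟨γ, hγ⟩ := WithTop.ne_top_iff_exists.1 (w.ne_top_iff.2 hθφ)
    have hlt : μ φ < γ := hγ ▸ hiff.1 hdvd
    have hFγ := hφ.natDegree_nsmul_augmentation_eq hlt.le hw hμ hF hFirr hθ hγ.symm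
    exact ⟨.inr ⟨γ, hγ, hφ.isOneSided_newtonPolygon hw hμ hF hFirr hθ hlt hγ.symm⟩,
      hφ.natDegree_dvd_natDegree hlt hF hFγ, hφ.muEquiv_pow hlt hF hFγ⟩

theorem mainTheorem9 {K : Type*} [Field K]
    {Λ : Type*} [AddCommGroup Λ] [LinearOrder Λ] [IsOrderedAddMonoid Λ] [Module ℚ Λ]
    (v : AddValuation K (WithTop Λ)) (hv : ValTree.IsHenselian v)
    (vbar : AddValuation (AlgebraicClosure K) (WithTop Λ))
    (hvbar : ∀ a : K, vbar (algebraMap K (AlgebraicClosure K) a) = v a)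
    (F : Polynomial K) (hFmonic : F.Monic) (hFirr : Irreducible F)
    (θ : AlgebraicClosure K) (hθ : Polynomial.aeval θ F = 0)
    (μ : AddValuation (Polynomial K) (WithTop Λ)) (hμ : ValTree.IsNode v μ)
    (φ : Polynomial K) (hφ : ValTree.IsKeyPolynomial μ φ) :
    (ValTree.MuDvd μ φ F ↔ μ φ < ValTree.evalValuation vbar θ φ) ∧
    (ValTree.MuDvd μ φ F →
      (F = φ ∨ ∃ γ : Λ, (γ : WithTop Λ) = ValTree.evalValuation vbar θ φ ∧
        ValTree.IsOneSided (ValTree.newtonPolygon μ φ F) (-γ)) ∧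
      (φ.natDegree ∣ F.natDegree ∧
        ValTree.MuEquiv μ F (φ ^ (F.natDegree / φ.natDegree)))) :=
  mainTheorem9_general (hv.map_algEquiv hvbar) hFmonic hFirr hθ
    (fun a => (hμ a).trans (hvbar a).symm) hφ
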